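/- Let $K$ be an arbitrary field, $n\ge 0$ and $m\ge 1$. Let $U$ be the group of upper unitriangular $n\times n$ matrices, acting on $H=\mathrm{Mat}(n)^m$ by $g\cdot(X_1,\dots,X_m)=(gX_1g^{-1},\dots,gX_mg^{-1})$, and on $K[H]$ and $K(H)$ by $\rho(g)f(X_1,\dots,X_m)=f(g^{-1}X_1g,\dots,g^{-1}X_mg)$. Let $K(H)^U$ be the field of invariants of $U$ as an algebraic group over $K$, that is, the field of all $f\in K(H)$ whose image in $\overline K(H)$ is fixed by every element of $U(\overline K)$, where $\overline K$ is an algebraic closure of $K$. For $1\le i\le n$ put $i'=n-i+1$. For an $n\times n$ matrix $X$ let * $M_{ij}(X)$, for $i'\le j$, be the minor of order $i'$ with rows $[i,n]$ and columns $[1,i'-1]\sqcup\{j\}$; * $N_{jk}(X)$, for $j\le k$, be the minor of order $k'$ with rows $\{j\}\sqcup[k+1,n]$ and columns $[1,k']$; * $D_k(X)$, for $1\le k\le n$, be the lower left corner minor of order $k'$. For $i'<k$ put $P_{ik}(X,Y)=\sum_{i'\le j\le k}M_{ij}(X)N_{jk}(Y)$ and $P_{ik}(X)=P_{ik}(X,X)$.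 **Theorem.** The field $K(H)^U$ is freely generated over $K$ by the system consisting of the polynomials $P_{ik}(X_1,X_\ell)$ ($2\le\ell\le m$, $i'<k$), $P_{ik}(X_\ell)$ ($1\le\ell\le m$, $i'<k$) and $D_k(X_\ell)$ ($1\le\ell\le m$, $1\le k\le n$): these polynomials, as a family indexed by all these labels, are algebraically independent over $K$, and they generate the field $K(H)^U$ over $K$. If $K$ is infinite, the same system also freely generates over $K$ the field $\{f\in K(H):\rho(g)f=f\text{ for all }g\in U(K)\}$. -/

import Mathlib

namespace MatrixTuples

/-! ### The minors and the polynomials `P_{ik}`, `D_k`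

Rows and columns are indexed by `Fin n`, i.e. from `0` to `n - 1`, and `i' = Fin.rev i` is the
index symmetric to `i`. The interval `[i, last]` has `n - i` elements; this is the number `i'` of
the enumeration from `1` to `n`, which is the order of the minors below. -/

section Minors

variable {R : Type*} [CommRing R] {n : ℕ}

/-- `M_{ij}(X)`: the minor of order `n - i` with rows `[i, last]` and columns the first
`n - i - 1` ones followed by column `j` (used for `i' ≤ j`). -/
def minorM (X : Matrix (Fin n) (Fin n) R) (i j : Fin n) : R :=
  (X.submatrix
    (fun r : Fin (n - i) => (⟨i + r, by omega⟩ : Fin n))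
    (fun c : Fin (n - i) => if (c : ℕ) + 1 < n - i then (⟨c, by omega⟩ : Fin n) else j)).det

/-- `N_{jk}(Y)`: the minor of order `n - k` with rows `j` followed by `[k + 1, last]`, and columns
the first `n - k` ones (used for `j ≤ k`). -/
def minorN (Y : Matrix (Fin n) (Fin n) R) (j k : Fin n) : R :=
  (Y.submatrix
    (fun r : Fin (n - k) => if (r : ℕ) = 0 then j else (⟨k + r, by omega⟩ : Fin n))
    (fun c : Fin (n - k) => (⟨c, by omega⟩ : Fin n))).det

/-- `D_k(X)`: the lower left corner minor of order `n - k`. -/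
def cornerD (X : Matrix (Fin n) (Fin n) R) (k : Fin n) : R :=
  (X.submatrix
    (fun r : Fin (n - k) => (⟨k + r, by omega⟩ : Fin n))
    (fun c : Fin (n - k) => (⟨c, by omega⟩ : Fin n))).det

/-- `P_{ik}(X, Y) = ∑_{i' ≤ j ≤ k} M_{ij}(X) N_{jk}(Y)` (used for `i' < k`). -/
def mixedP (X Y : Matrix (Fin n) (Fin n) R) (i k : Fin n) : R :=
  ∑ j ∈ Finset.Icc i.rev k, minorM X i j * minorN Y j k

end Minors

/-! ### The group `U` -/

/-- The group `U` of upper triangular matrices with ones on the diagonal. -/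
def unitriangular (K : Type*) [Field K] (n : ℕ) : Subgroup (Matrix.GeneralLinearGroup (Fin n) K) where
  carrier := {g | (∀ i j, j < i → (g : Matrix (Fin n) (Fin n) K) i j = 0) ∧
    ∀ i, (g : Matrix (Fin n) (Fin n) K) i i = 1}
  one_mem' := by
    refine ⟨fun i j h => ?_, fun i => ?_⟩
    · simp [h.ne']
    · simp
  mul_mem' := by
    rintro a b ⟨ha, ha'⟩ ⟨hb, hb'⟩
    refine ⟨fun i j h => ?_, fun i => ?_⟩
    · rw [Units.val_mul, Matrix.mul_apply]
      refine Finset.sum_eq_zero fun k _ => ?_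
      rcases lt_or_ge k i with hk | hk
      · rw [ha i k hk, zero_mul]
      · rw [hb k j (lt_of_lt_of_le h hk), mul_zero]
    · rw [Units.val_mul, Matrix.mul_apply, Finset.sum_eq_single i]
      · rw [ha', hb', one_mul]
      · intro k _ hk
        rcases lt_or_gt_of_ne hk with hk | hk
        · rw [ha i k hk, zero_mul]
        · rw [hb k i hk, mul_zero]
      · simp
  inv_mem' := by
    rintro a ⟨ha, ha'⟩
    have hT : Matrix.BlockTriangular (a : Matrix (Fin n) (Fin n) K) id := fun i j h => ha i j h
    have hI : ∀ i j, j < i → ((a⁻¹ : Matrix.GeneralLinearGroup (Fin n) K) :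
        Matrix (Fin n) (Fin n) K) i j = 0 := by
      intro i j h
      let _ : Invertible (a : Matrix (Fin n) (Fin n) K) := a.invertible
      have := Matrix.blockTriangular_inv_of_blockTriangular hT
      rw [Matrix.coe_units_inv]
      exact this h
    refine ⟨hI, fun i => ?_⟩
    have h1 : ((a : Matrix (Fin n) (Fin n) K) * ((a⁻¹ : Matrix.GeneralLinearGroup (Fin n) K) :
        Matrix (Fin n) (Fin n) K)) i i = 1 := by
      rw [Units.mul_inv]; simp
    rw [Matrix.mul_apply, Finset.sum_eq_single i] at h1
    · rwa [ha', one_mul] at h1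
    · intro k _ hk
      rcases lt_or_gt_of_ne hk with hk | hk
      · rw [ha i k hk, zero_mul]
      · rw [hI k i hk, mul_zero]
    · simp

/-! ### The coordinate ring and the function field of the space of matrix tuples -/

/-- The algebra `K[H]` of polynomial functions on `H = Mat(n)^m`: the variable `(ℓ, i, j)` is the
entry `(i, j)` of the `ℓ`-th matrix. -/
abbrev CoordRing (K : Type*) [Field K] (n m : ℕ) : Type _ :=
  MvPolynomial (Fin m × Fin n × Fin n) K

/-- The field `K(H)` of rational functions on `H = Mat(n)^m`. -/
abbrev FunctionField (K : Type*) [Field K] (n m : ℕ) : Type _ :=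
  FractionRing (CoordRing K n m)

section Action

variable {K : Type*} [Field K] {n m : ℕ}

/-- The matrix `X_ℓ` of coordinate functions on the `ℓ`-th component. -/
noncomputable def genericMatrix (K : Type*) [Field K] (n m : ℕ) (ℓ : Fin m) :
    Matrix (Fin n) (Fin n) (CoordRing K n m) :=
  Matrix.of fun i j => MvPolynomial.X (ℓ, i, j)

/-- A matrix over `K`, as a matrix of constant functions on `H`. -/
noncomputable def constMatrix (m : ℕ) (A : Matrix (Fin n) (Fin n) K) :
    Matrix (Fin n) (Fin n) (CoordRing K n m) :=
  A.map MvPolynomial.C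

/-- The substitution `f(X_1, …, X_m) ↦ f(g⁻¹ X_1 g, …, g⁻¹ X_m g)` on polynomials. -/
noncomputable def conjSubst (m : ℕ) (g : Matrix.GeneralLinearGroup (Fin n) K) :
    CoordRing K n m →ₐ[K] CoordRing K n m :=
  MvPolynomial.aeval fun v =>
    (constMatrix m ((g⁻¹ : Matrix.GeneralLinearGroup (Fin n) K) : Matrix (Fin n) (Fin n) K) *
      genericMatrix K n m v.1 * constMatrix m (g : Matrix (Fin n) (Fin n) K)) v.2.1 v.2.2

theorem constMatrix_mul (A B : Matrix (Fin n) (Fin n) K) :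
    constMatrix m (A * B) = constMatrix m A * constMatrix m B :=
  Matrix.map_mul

theorem map_genericMatrix (g : Matrix.GeneralLinearGroup (Fin n) K) (ℓ : Fin m) :
    (genericMatrix K n m ℓ).map (conjSubst m g) =
      constMatrix m ((g⁻¹ : Matrix.GeneralLinearGroup (Fin n) K) : Matrix (Fin n) (Fin n) K) *
      genericMatrix K n m ℓ * constMatrix m (g : Matrix (Fin n) (Fin n) K) := by
  ext1 i j
  simp [genericMatrix, conjSubst]

theorem map_constMatrix (g : Matrix.GeneralLinearGroup (Fin n) K)
    (A : Matrix (Fin n) (Fin n) K) :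
    (constMatrix m A).map (conjSubst m g) = constMatrix m A := by
  ext1 i j
  simp [constMatrix, conjSubst]

theorem conjSubst_one : conjSubst m (1 : Matrix.GeneralLinearGroup (Fin n) K) = AlgHom.id K _ := by
  apply MvPolynomial.algHom_ext
  rintro ⟨ℓ, i, j⟩
  have h1 : constMatrix m (1 : Matrix (Fin n) (Fin n) K) = 1 :=
    Matrix.map_one _ MvPolynomial.C.map_zero MvPolynomial.C.map_one
  simp [conjSubst, h1, genericMatrix]

theorem conjSubst_mul (g h : Matrix.GeneralLinearGroup (Fin n) K) :
    conjSubst m (g * h) = (conjSubst m g).comp (conjSubst m h) := by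
  apply MvPolynomial.algHom_ext
  rintro ⟨ℓ, i, j⟩
  have key : (genericMatrix K n m ℓ).map (conjSubst m (g * h)) =
      ((genericMatrix K n m ℓ).map (conjSubst m h)).map (conjSubst m g) := by
    rw [map_genericMatrix, map_genericMatrix, Matrix.map_mul, Matrix.map_mul, map_constMatrix,
      map_constMatrix, map_genericMatrix, mul_inv_rev, Units.val_mul, Units.val_mul,
      constMatrix_mul, constMatrix_mul]
    simp only [Matrix.mul_assoc]
  exact congrFun (congrFun key i) j

/-- The representation `ρ(g) f(X_1, …, X_m) = f(g⁻¹ X_1 g, …, g⁻¹ X_m g)` of `GL(n)` on `K[H]`. -/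
noncomputable def rhoPoly (K : Type*) [Field K] (n m : ℕ) :
    Matrix.GeneralLinearGroup (Fin n) K →* (CoordRing K n m ≃ₐ[K] CoordRing K n m) where
  toFun g := AlgEquiv.ofAlgHom (conjSubst m g) (conjSubst m g⁻¹)
    (by rw [← conjSubst_mul, mul_inv_cancel, conjSubst_one])
    (by rw [← conjSubst_mul, inv_mul_cancel, conjSubst_one])
  map_one' := by
    ext1 f
    exact DFunLike.congr_fun conjSubst_one f
  map_mul' g h := by
    ext1 f
    exact DFunLike.congr_fun (conjSubst_mul g h) f

/-- The extension of the action `ρ` to the field `K(H)` of rational functions. -/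
noncomputable def rho (K : Type*) [Field K] (n m : ℕ) :
    Matrix.GeneralLinearGroup (Fin n) K →* (FunctionField K n m ≃ₐ[K] FunctionField K n m) :=
  (IsFractionRing.fieldEquivOfAlgEquivHom K (FunctionField K n m)).comp (rhoPoly K n m)

end Action

/-! ### The fields of `U`-invariants -/

/-- The field of rational functions fixed by every element of the abstract group `U(K)`. -/
noncomputable def pointInvariants (K : Type*) [Field K] (n m : ℕ) :
    IntermediateField K (FunctionField K n m) :=
  IntermediateField.fixedField ((unitriangular K n).map (rho K n m))

/-- Extension of scalars on polynomials, `K[H] → L[H] ⊆ L(H)`. -/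
noncomputable def extendScalarsPoly (K L : Type*) [Field K] [Field L] [Algebra K L] (n m : ℕ) :
    CoordRing K n m →ₐ[K] FunctionField L n m :=
  (IsScalarTower.toAlgHom K (CoordRing L n m) (FunctionField L n m)).comp
    (MvPolynomial.mapAlgHom (Algebra.ofId K L))

theorem extendScalarsPoly_apply (K L : Type*) [Field K] [Field L] [Algebra K L] (n m : ℕ)
    (f : CoordRing K n m) :
    extendScalarsPoly K L n m f =
      algebraMap (CoordRing L n m) (FunctionField L n m) (MvPolynomial.map (algebraMap K L) f) :=
  rfl

theorem extendScalarsPoly_injective (K L : Type*) [Field K] [Field L] [Algebra K L] (n m : ℕ) :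
    Function.Injective (extendScalarsPoly K L n m) := fun f g h =>
  MvPolynomial.map_injective _ (algebraMap K L).injective
    (IsFractionRing.injective (CoordRing L n m) (FunctionField L n m) h)

/-- Extension of scalars `K(H) → L(H)`. -/
noncomputable def extendScalars (K L : Type*) [Field K] [Field L] [Algebra K L] (n m : ℕ) :
    FunctionField K n m →ₐ[K] FunctionField L n m :=
  IsFractionRing.liftAlgHom (extendScalarsPoly_injective K L n m)

/-- The field `K(H)^U` of invariants of the algebraic group `U` over `K`: the rational functions
over `K` that are fixed by `U(K̄)` in `K̄(H)`, where `K̄` is an algebraic closure of `K`. -/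
noncomputable def groupInvariants (K : Type*) [Field K] (n m : ℕ) :
    IntermediateField K (FunctionField K n m) :=
  IntermediateField.comap (extendScalars K (AlgebraicClosure K) n m)
    ((pointInvariants (AlgebraicClosure K) n m).restrictScalars K)

/-! ### The generators -/

/-- The pairs `(i, k)` with `i' < k`. -/
abbrev BelowAntidiagonal (n : ℕ) : Type := {p : Fin n × Fin n // p.1.rev < p.2}

/-- Labels of the generators. The first matrix of the tuple is the one with index `0`. -/
inductive GenIndex (n m : ℕ) [NeZero m] : Type
  /-- the label of `P_{ik}(X_1, X_ℓ)`, where `X_ℓ` is not the first matrix -/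
  | mixed (ℓ : {ℓ : Fin m // ℓ ≠ 0}) (p : BelowAntidiagonal n)
  /-- the label of `P_{ik}(X_ℓ)` -/
  | single (ℓ : Fin m) (p : BelowAntidiagonal n)
  /-- the label of `D_k(X_ℓ)` -/
  | corner (ℓ : Fin m) (k : Fin n)

/-- The system of polynomials `P_{ik}(X_1, X_ℓ)`, `P_{ik}(X_ℓ) = P_{ik}(X_ℓ, X_ℓ)`, `D_k(X_ℓ)`. -/
noncomputable def genPoly (K : Type*) [Field K] (n m : ℕ) [NeZero m] :
    GenIndex n m → CoordRing K n m
  | .mixed ℓ p => mixedP (genericMatrix K n m 0) (genericMatrix K n m ℓ.1) p.1.1 p.1.2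
  | .single ℓ p => mixedP (genericMatrix K n m ℓ) (genericMatrix K n m ℓ) p.1.1 p.1.2
  | .corner ℓ k => cornerD (genericMatrix K n m ℓ) k

/-- The same system, as a system of elements of `K(H)`. -/
noncomputable def gen (K : Type*) [Field K] (n m : ℕ) [NeZero m] (a : GenIndex n m) :
    FunctionField K n m :=
  algebraMap (CoordRing K n m) (FunctionField K n m) (genPoly K n m a)

/-- The subfield `F` is freely generated over `K` by the family `b`: the members of `b` are
algebraically independent over `K`, and `F` is the field that they generate over `K`. -/
def FreelyGenerates {K E ι : Type*} [Field K] [Field E] [Algebra K E]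
    (b : ι → E) (F : IntermediateField K E) : Prop :=
  AlgebraicIndependent K b ∧ IntermediateField.adjoin K (Set.range b) = F

end MatrixTuples

/-! Collect the minors into matrices M(X) = `matM X` and N(X) = `matN X`. For unitriangular g one
has M(gX) = M(X), M(Xg) = M(X)g, N(gX) = gN(X) and N(Xg) = N(X). Hence M(X)N(Y) is unchanged when X
and Y are conjugated simultaneously. Its entries are the P_{ik}(X, Y): they vanish for k < i' and
are products of two corner minors for k = i', so only i' < k gives new invariants.

Generation rests on a Gauss-type decomposition X = N(X) C M(X), with C diagonal and built from
corner minors (`eq_matN_mul_matM`). Normalizing the columns of N(X_1) gives a unitriangular u over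
K(H). The matrices u⁻¹ X_ℓ u can then be written through the products M(X_1)N(X_1), M(X_1)N(X_ℓ),
M(X_ℓ)N(X_ℓ) and corner minors, so their entries lie in the field F generated by the system
(`exists_conj_entriesIn`).

An invariant f should therefore equal its value at the conjugated tuple, which lies in F. Two
obstacles remain. First, u is not a point of U over the base field; invariance over an infinite
field is a polynomial identity in the entries of g, so it extends to matrices over any commutative
algebra (`evalTuple_conj_of_infinite`). Second, the denominator of f may vanish at the conjugated
tuple; conjugating by u times a generic unitriangular matrix and comparing coefficients avoids this
(`evalTuple_div_mem`).

For independence, the system and the entries of u above the diagonal together generate K(H), and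
there are no more of them than coordinates on H. They thus form a transcendence basis, and the
system is part of it. -/

namespace MatrixTuples

open scoped Matrix

/-! ### Unitriangular matrices and submatrices of products -/

section Unitriangular

variable {R : Type*} [CommRing R] {n : ℕ}

/-- Upper triangular matrices with ones on the diagonal, over a commutative ring. -/
def IsUnitriangular (g : Matrix (Fin n) (Fin n) R) : Prop :=
  (∀ i j, j < i → g i j = 0) ∧ ∀ i, g i i = 1

theorem IsUnitriangular.det {g : Matrix (Fin n) (Fin n) R} (hg : IsUnitriangular g) :
    g.det = 1 := by
  rw [Matrix.det_of_isUpperTriangular (fun i j h => hg.1 i j h)]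
  exact Finset.prod_eq_one fun i _ => hg.2 i

theorem IsUnitriangular.mul {g h : Matrix (Fin n) (Fin n) R} (hg : IsUnitriangular g)
    (hh : IsUnitriangular h) : IsUnitriangular (g * h) := by
  refine ⟨fun i j hij => ?_, fun i => ?_⟩
  · rw [Matrix.mul_apply]
    refine Finset.sum_eq_zero fun k _ => ?_
    rcases lt_or_ge k i with hk | hk
    · rw [hg.1 i k hk, zero_mul]
    · rw [hh.1 k j (hij.trans_le hk), mul_zero]
  · rw [Matrix.mul_apply, Finset.sum_eq_single i]
    · rw [hg.2, hh.2, one_mul]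
    · intro k _ hk
      rcases lt_or_gt_of_ne hk with hk | hk
      · rw [hg.1 i k hk, zero_mul]
      · rw [hh.1 k i hk, mul_zero]
    · simp

theorem IsUnitriangular.map {S : Type*} [CommRing S] (f : R →+* S)
    {g : Matrix (Fin n) (Fin n) R} (hg : IsUnitriangular g) : IsUnitriangular (g.map f) :=
  ⟨fun i j h => by simp [hg.1 i j h], fun i => by simp [hg.2 i]⟩

theorem IsUnitriangular.mul_adjugate {g : Matrix (Fin n) (Fin n) R} (hg : IsUnitriangular g) :
    g * g.adjugate = 1 := by
  rw [Matrix.mul_adjugate, hg.det, one_smul]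

theorem IsUnitriangular.adjugate_mul {g : Matrix (Fin n) (Fin n) R} (hg : IsUnitriangular g) :
    g.adjugate * g = 1 := by
  rw [Matrix.adjugate_mul, hg.det, one_smul]

theorem IsUnitriangular.submatrix {s : ℕ} {g : Matrix (Fin n) (Fin n) R} (hg : IsUnitriangular g)
    {φ : Fin s → Fin n} (hφ : StrictMono φ) : IsUnitriangular (g.submatrix φ φ) :=
  ⟨fun _ _ h => hg.1 _ _ (hφ h), fun _ => hg.2 _⟩

/-- The first column of the adjugate of a unitriangular matrix is the first unit vector. -/
theorem IsUnitriangular.adjugate_col {g : Matrix (Fin n) (Fin n) R} (hg : IsUnitriangular g)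
    {a : Fin n} (ha : (a : ℕ) = 0) : g.adjugate *ᵥ Pi.single a 1 = Pi.single a 1 := by
  have h : g *ᵥ Pi.single a 1 = Pi.single a 1 := by
    ext i
    rw [Matrix.mulVec_single_one, Matrix.col_apply]
    rcases eq_or_ne i a with rfl | hi
    · rw [hg.2, Pi.single_eq_same]
    · rw [Pi.single_eq_of_ne hi, hg.1 i a (by rw [Fin.lt_def]; have := Fin.val_ne_of_ne hi; omega)]
  conv_lhs => rw [← h]
  rw [Matrix.mulVec_mulVec, hg.adjugate_mul, Matrix.one_mulVec]

/-- The last row of the adjugate of a unitriangular matrix is the last unit vector. -/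
theorem IsUnitriangular.adjugate_row {g : Matrix (Fin n) (Fin n) R} (hg : IsUnitriangular g)
    {a : Fin n} (ha : (a : ℕ) + 1 = n) : Pi.single a 1 ᵥ* g.adjugate = Pi.single a 1 := by
  have h : Pi.single a 1 ᵥ* g = Pi.single a 1 := by
    ext i
    rw [Matrix.single_one_vecMul, Matrix.row_apply]
    rcases eq_or_ne i a with rfl | hi
    · rw [hg.2, Pi.single_eq_same]
    · rw [Pi.single_eq_of_ne hi, hg.1 a i (by rw [Fin.lt_def]; have := Fin.val_ne_of_ne hi; omega)]
  conv_lhs => rw [← h]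
  rw [Matrix.vecMul_vecMul, hg.mul_adjugate, Matrix.vecMul_one]

/-- The rows of `A` picked out by `φ` are supported on the columns `φ`, so the sum over the middle
index shrinks to the image of `φ`. -/
theorem submatrix_mul_of_support_left {s t : ℕ} (A B : Matrix (Fin n) (Fin n) R)
    {φ : Fin s → Fin n} (ψ : Fin t → Fin n) (hφ : Function.Injective φ)
    (hA : ∀ r k, k ∉ Set.range φ → A (φ r) k = 0) :
    (A * B).submatrix φ ψ = A.submatrix φ φ * B.submatrix φ ψ := by
  ext r c
  simp only [Matrix.submatrix_apply, Matrix.mul_apply]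
  rw [← Finset.sum_image (s := Finset.univ) (g := φ) (f := fun k => A (φ r) k * B k (ψ c))
    (fun _ _ _ _ h => hφ h)]
  symm
  refine Finset.sum_subset (Finset.subset_univ _) fun k _ hk => ?_
  rw [hA r k (by simpa using hk), zero_mul]

theorem submatrix_mul_of_support_right {s t : ℕ} (A B : Matrix (Fin n) (Fin n) R)
    (φ : Fin s → Fin n) {ψ : Fin t → Fin n} (hψ : Function.Injective ψ)
    (hB : ∀ c k, k ∉ Set.range ψ → B k (ψ c) = 0) :
    (A * B).submatrix φ ψ = A.submatrix φ ψ * B.submatrix ψ ψ := by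
  ext r c
  simp only [Matrix.submatrix_apply, Matrix.mul_apply]
  rw [← Finset.sum_image (s := Finset.univ) (g := ψ) (f := fun k => A (φ r) k * B k (ψ c))
    (fun _ _ _ _ h => hψ h)]
  symm
  refine Finset.sum_subset (Finset.subset_univ _) fun k _ hk => ?_
  rw [hB c k (by simpa using hk), mul_zero]

end Unitriangular

/-! ### The minors under multiplication by unitriangular matrices -/

section Corner

variable {R : Type*} [CommRing R] {n : ℕ}

/-- The rows `[k, last]`. -/
def lowerRow (k : Fin n) (r : Fin (n - k)) : Fin n := ⟨k + r, by omega⟩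

/-- The first `n - k` columns. -/
def leftCol (k : Fin n) (c : Fin (n - k)) : Fin n := ⟨c, by omega⟩

theorem lowerRow_strictMono (k : Fin n) : StrictMono (lowerRow k) := fun a b h => by
  rw [Fin.lt_def] at h ⊢
  exact Nat.add_lt_add_left h _

theorem leftCol_strictMono (k : Fin n) : StrictMono (leftCol k) := fun a b h => by
  rw [Fin.lt_def] at h ⊢
  exact h

/-- The lower left corner of order `n - k`. -/
def corner (X : Matrix (Fin n) (Fin n) R) (k : Fin n) : Matrix (Fin (n - k)) (Fin (n - k)) R :=
  X.submatrix (lowerRow k) (leftCol k)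

theorem submatrix_lowerRow_mul {g : Matrix (Fin n) (Fin n) R} (hg : IsUnitriangular g)
    (X : Matrix (Fin n) (Fin n) R) (k : Fin n) {t : ℕ} (ψ : Fin t → Fin n) :
    (g * X).submatrix (lowerRow k) ψ =
      g.submatrix (lowerRow k) (lowerRow k) * X.submatrix (lowerRow k) ψ := by
  refine submatrix_mul_of_support_left _ _ _ (lowerRow_strictMono k).injective fun r j hj => ?_
  refine hg.1 _ _ ?_
  by_contra h
  rw [Fin.lt_def, lowerRow, not_lt, Fin.val_mk] at h
  exact hj ⟨⟨j - k, by omega⟩, Fin.ext (by simp only [lowerRow]; omega)⟩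

theorem submatrix_mul_leftCol {h : Matrix (Fin n) (Fin n) R} (hh : IsUnitriangular h)
    (X : Matrix (Fin n) (Fin n) R) (k : Fin n) {t : ℕ} (φ : Fin t → Fin n) :
    (X * h).submatrix φ (leftCol k) =
      X.submatrix φ (leftCol k) * h.submatrix (leftCol k) (leftCol k) := by
  refine submatrix_mul_of_support_right _ _ _ (leftCol_strictMono k).injective fun r j hj => ?_
  refine hh.1 _ _ ?_
  by_contra h
  rw [Fin.lt_def, leftCol, not_lt, Fin.val_mk] at h
  exact hj ⟨⟨j, Nat.lt_of_le_of_lt h r.isLt⟩, rfl⟩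

/-- Cramer's rule: the minor is the corner determinant with its last column replaced by column j of
X. The coefficients do not depend on j, which makes the effect of column operations visible. -/
theorem minorM_eq_sum (X : Matrix (Fin n) (Fin n) R) (i j : Fin n) :
    minorM X i j =
      ∑ r, (corner X i).adjugate ⟨n - i - 1, by omega⟩ r * X (lowerRow i r) j := by
  have h := Matrix.cramer_apply (corner X i) (fun r => X (lowerRow i r) j) ⟨n - i - 1, by omega⟩
  rw [Matrix.cramer_eq_adjugate_mulVec] at h
  refine Eq.trans ?_ h.symm
  rw [minorM]
  congr 1
  ext r c
  rw [Matrix.updateCol_apply, Matrix.submatrix_apply]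
  by_cases hc : (c : ℕ) + 1 < n - i
  · rw [if_pos hc, if_neg (by rw [Fin.ext_iff]; simp only; omega)]
    rfl
  · rw [if_neg hc, if_pos (by rw [Fin.ext_iff]; simp only; omega)]
    rfl

theorem minorN_eq_sum (Y : Matrix (Fin n) (Fin n) R) (j k : Fin n) :
    minorN Y j k =
      ∑ c, Y j (leftCol k c) * (corner Y k).adjugate c ⟨0, by omega⟩ := by
  have h := Matrix.cramer_transpose_apply (corner Y k) (fun c => Y j (leftCol k c)) ⟨0, by omega⟩
  rw [Matrix.cramer_eq_adjugate_mulVec, ← Matrix.adjugate_transpose, Matrix.mulVec_transpose] at h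
  refine Eq.trans ?_ h.symm
  rw [minorN]
  congr 1
  ext r c
  rw [Matrix.updateRow_apply, Matrix.submatrix_apply]
  by_cases hr : (r : ℕ) = 0
  · rw [if_pos hr, if_pos (Fin.ext hr)]
    rfl
  · rw [if_neg hr, if_neg (by rw [Fin.ext_iff]; simpa using hr)]
    rfl

/-- The minors `M_{ij}(X)`, for all `i` and `j`, as a matrix. -/
def matM (X : Matrix (Fin n) (Fin n) R) : Matrix (Fin n) (Fin n) R := Matrix.of (minorM X)

/-- The minors `N_{jk}(X)`, for all `j` and `k`, as a matrix. -/
def matN (X : Matrix (Fin n) (Fin n) R) : Matrix (Fin n) (Fin n) R := Matrix.of (minorN X)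

theorem matM_mul_left {g : Matrix (Fin n) (Fin n) R} (hg : IsUnitriangular g)
    (X : Matrix (Fin n) (Fin n) R) : matM (g * X) = matM X := by
  ext i j
  have h := submatrix_lowerRow_mul hg X i (fun c : Fin (n - i) =>
    if (c : ℕ) + 1 < n - i then (⟨c, by omega⟩ : Fin n) else j)
  have h' := congrArg Matrix.det h
  rw [Matrix.det_mul, (hg.submatrix (lowerRow_strictMono i)).det, one_mul] at h'
  exact h'

theorem matN_mul_right {h : Matrix (Fin n) (Fin n) R} (hh : IsUnitriangular h)
    (X : Matrix (Fin n) (Fin n) R) : matN (X * h) = matN X := by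
  ext j k
  have h' := congrArg Matrix.det (submatrix_mul_leftCol hh X k (fun r : Fin (n - k) =>
    if (r : ℕ) = 0 then j else (⟨k + r, by omega⟩ : Fin n)))
  rw [Matrix.det_mul, (hh.submatrix (leftCol_strictMono k)).det, mul_one] at h'
  exact h'

/-- The corner of X is multiplied on the right by a unitriangular block of h. The adjugate of that
block has the last unit vector as its last row, so the coefficients in `minorM_eq_sum` do not change
and only column j of X is transformed. -/
theorem matM_mul_right {h : Matrix (Fin n) (Fin n) R} (hh : IsUnitriangular h)
    (X : Matrix (Fin n) (Fin n) R) : matM (X * h) = matM X * h := by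
  ext i j
  have key : ∀ r, (corner (X * h) i).adjugate ⟨n - i - 1, by omega⟩ r =
      (corner X i).adjugate ⟨n - i - 1, by omega⟩ r := fun r => by
    have h1 : (corner (X * h) i).adjugate =
        (h.submatrix (leftCol i) (leftCol i)).adjugate * (corner X i).adjugate := by
      rw [corner, submatrix_mul_leftCol hh, Matrix.adjugate_mul_distrib]
      rfl
    have h2 := (hh.submatrix (leftCol_strictMono i)).adjugate_row
      (a := ⟨n - i - 1, by omega⟩) (by simp only; omega)
    have h3 := congrArg (fun v => (v ᵥ* (corner X i).adjugate) r) h2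
    rwa [Matrix.vecMul_vecMul, ← h1, Matrix.single_one_vecMul, Matrix.single_one_vecMul] at h3
  rw [Matrix.mul_apply]
  simp only [matM, Matrix.of_apply, minorM_eq_sum, key, Matrix.mul_apply, Finset.mul_sum,
    Finset.sum_mul, mul_assoc]
  exact Finset.sum_comm

/-- Dual to `matM_mul_right`: the first column of the adjugate of the corner does not change. -/
theorem matN_mul_left {g : Matrix (Fin n) (Fin n) R} (hg : IsUnitriangular g)
    (X : Matrix (Fin n) (Fin n) R) : matN (g * X) = g * matN X := by
  ext j k
  have key : ∀ c, (corner (g * X) k).adjugate c ⟨0, by omega⟩ =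
      (corner X k).adjugate c ⟨0, by omega⟩ := fun c => by
    have h1 : (corner (g * X) k).adjugate =
        (corner X k).adjugate * (g.submatrix (lowerRow k) (lowerRow k)).adjugate := by
      rw [corner, submatrix_lowerRow_mul hg, Matrix.adjugate_mul_distrib]
      rfl
    have h2 := (hg.submatrix (lowerRow_strictMono k)).adjugate_col (a := ⟨0, by omega⟩) rfl
    have h3 := congrArg (fun v => ((corner X k).adjugate *ᵥ v) c) h2
    rwa [Matrix.mulVec_mulVec, ← h1, Matrix.mulVec_single_one, Matrix.mulVec_single_one] at h3
  rw [Matrix.mul_apply]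
  simp only [matN, Matrix.of_apply, minorN_eq_sum, key, Matrix.mul_apply, Finset.mul_sum,
    Finset.sum_mul, mul_assoc]
  exact Finset.sum_comm

theorem minorN_self (X : Matrix (Fin n) (Fin n) R) (k : Fin n) : minorN X k k = cornerD X k := by
  rw [minorN, cornerD]
  congr 2
  funext r
  split_ifs with h
  · exact Fin.ext (by simp [h])
  · rfl

theorem minorM_rev (X : Matrix (Fin n) (Fin n) R) (i : Fin n) :
    minorM X i i.rev = cornerD X i := by
  rw [minorM, cornerD]
  congr 2
  funext c
  split_ifs with h
  · rfl
  · exact Fin.ext (by simp only [Fin.val_rev]; omega)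

/-- Row j already occurs among the rows below k, so the minor has two equal rows. -/
theorem minorN_eq_zero (X : Matrix (Fin n) (Fin n) R) {j k : Fin n} (h : k < j) :
    minorN X j k = 0 := by
  rw [Fin.lt_def] at h
  refine Matrix.det_zero_of_row_eq (i := ⟨0, by omega⟩) (j := ⟨j - k, by omega⟩)
    (by rw [ne_eq, Fin.ext_iff]; simp only; omega) ?_
  ext c
  simp only [Matrix.submatrix_apply]
  rw [if_pos trivial, if_neg (by omega)]
  congr 1
  exact Fin.ext (by simp only; omega)

theorem minorM_eq_zero (X : Matrix (Fin n) (Fin n) R) {i j : Fin n} (h : j < i.rev) :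
    minorM X i j = 0 := by
  rw [Fin.lt_def, Fin.val_rev] at h
  refine Matrix.det_zero_of_column_eq (i := ⟨n - i - 1, by omega⟩) (j := ⟨j, by omega⟩)
    (by rw [ne_eq, Fin.ext_iff]; simp only; omega) ?_
  intro r
  simp only [Matrix.submatrix_apply]
  rw [if_neg (by omega), if_pos (by omega)]

theorem cornerD_mul_left {g : Matrix (Fin n) (Fin n) R} (hg : IsUnitriangular g)
    (X : Matrix (Fin n) (Fin n) R) (k : Fin n) : cornerD (g * X) k = cornerD X k := by
  simpa [matM, minorM_rev] using congrFun (congrFun (matM_mul_left hg X) k) k.rev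

theorem cornerD_mul_right {h : Matrix (Fin n) (Fin n) R} (hh : IsUnitriangular h)
    (X : Matrix (Fin n) (Fin n) R) (k : Fin n) : cornerD (X * h) k = cornerD X k := by
  simpa [matN, minorN_self] using congrFun (congrFun (matN_mul_right hh X) k) k

theorem matM_mul_matN_apply (X Y : Matrix (Fin n) (Fin n) R) (i k : Fin n) :
    (matM X * matN Y) i k = mixedP X Y i k := by
  rw [Matrix.mul_apply, mixedP]
  symm
  refine Finset.sum_subset (Finset.subset_univ _) fun j _ hj => ?_
  rw [Finset.mem_Icc, not_and_or, not_le, not_le] at hj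
  rcases hj with hj | hj
  · rw [minorM_eq_zero X hj, zero_mul]
  · rw [minorN_eq_zero Y hj, mul_zero]

theorem mixedP_rev (X Y : Matrix (Fin n) (Fin n) R) (i : Fin n) :
    mixedP X Y i i.rev = cornerD X i * cornerD Y i.rev := by
  rw [mixedP, Finset.Icc_self, Finset.sum_singleton, minorM_rev, minorN_self]

theorem mixedP_eq_zero (X Y : Matrix (Fin n) (Fin n) R) {i k : Fin n} (h : k < i.rev) :
    mixedP X Y i k = 0 := by
  rw [mixedP, Finset.Icc_eq_empty (not_le.mpr h), Finset.sum_empty]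

/-- In M(X) h g N(Y) the two middle factors cancel. -/
theorem mixedP_conj {g h : Matrix (Fin n) (Fin n) R} (hg : IsUnitriangular g)
    (hh : IsUnitriangular h) (hgh : h * g = 1) (X Y : Matrix (Fin n) (Fin n) R) (i k : Fin n) :
    mixedP (g * X * h) (g * Y * h) i k = mixedP X Y i k := by
  rw [← matM_mul_matN_apply, ← matM_mul_matN_apply, matM_mul_right hh, matM_mul_left hg,
    matN_mul_right hh, matN_mul_left hg, Matrix.mul_assoc, ← Matrix.mul_assoc h, hgh,
    Matrix.one_mul]

theorem cornerD_conj {g h : Matrix (Fin n) (Fin n) R} (hg : IsUnitriangular g)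
    (hh : IsUnitriangular h) (X : Matrix (Fin n) (Fin n) R) (k : Fin n) :
    cornerD (g * X * h) k = cornerD X k := by
  rw [cornerD_mul_right hh, cornerD_mul_left hg]

theorem map_cornerD {S : Type*} [CommRing S] (f : R →+* S) (X : Matrix (Fin n) (Fin n) R)
    (k : Fin n) : cornerD (X.map f) k = f (cornerD X k) := by
  rw [cornerD, cornerD, RingHom.map_det]
  rfl

theorem map_mixedP {S : Type*} [CommRing S] (f : R →+* S) (X Y : Matrix (Fin n) (Fin n) R)
    (i k : Fin n) : mixedP (X.map f) (Y.map f) i k = f (mixedP X Y i k) := by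
  simp only [mixedP, map_sum, map_mul, minorM, minorN, RingHom.map_det]
  rfl

end Corner

/-! ### Gauss-type decomposition of a matrix with nonzero corner minors -/

section Decomposition

variable {R : Type*} [CommRing R] {n : ℕ}

/-- The lower left corner of order `n - k - 1`. -/
def nextCorner (X : Matrix (Fin n) (Fin n) R) (k : Fin n) :
    Matrix (Fin (n - (k + 1))) (Fin (n - (k + 1))) R :=
  X.submatrix (fun r => ⟨k + 1 + r, by omega⟩) (fun c => ⟨c, by omega⟩)

theorem det_nextCorner_of_lt (X : Matrix (Fin n) (Fin n) R) {k : Fin n} (h : (k : ℕ) + 1 < n) :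
    (nextCorner X k).det = cornerD X ⟨k + 1, h⟩ := rfl

/-- The empty determinant supplies the convention that the corner minor of order 0 is 1. -/
theorem det_nextCorner_of_le (X : Matrix (Fin n) (Fin n) R) {k : Fin n} (h : n ≤ (k : ℕ) + 1) :
    (nextCorner X k).det = 1 := by
  have : IsEmpty (Fin (n - (k + 1))) := by
    rw [Nat.sub_eq_zero_of_le h]
    infer_instance
  exact Matrix.det_isEmpty

theorem det_nextCorner_mul_left {g : Matrix (Fin n) (Fin n) R} (hg : IsUnitriangular g)
    (X : Matrix (Fin n) (Fin n) R) (k : Fin n) :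
    (nextCorner (g * X) k).det = (nextCorner X k).det := by
  rcases lt_or_ge ((k : ℕ) + 1) n with h | h
  · rw [det_nextCorner_of_lt _ h, det_nextCorner_of_lt _ h, cornerD_mul_left hg]
  · rw [det_nextCorner_of_le _ h, det_nextCorner_of_le _ h]

theorem det_submatrix_of_row_zero (t : Matrix (Fin n) (Fin n) R) {s : ℕ}
    (ρ γ : Fin (s + 1) → Fin n) (h : ∀ c, c ≠ Fin.last s → t (ρ 0) (γ c) = 0) :
    (t.submatrix ρ γ).det = (-1) ^ s * t (ρ 0) (γ (Fin.last s)) *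
      (t.submatrix (ρ ∘ Fin.succ) (γ ∘ Fin.castSucc)).det := by
  rw [Matrix.det_succ_row_zero, Finset.sum_eq_single (Fin.last s)]
  · rw [Fin.val_last, Matrix.submatrix_apply, Matrix.submatrix_submatrix, Fin.succAbove_last]
  · intro c _ hc
    rw [Matrix.submatrix_apply, h c hc, mul_zero, zero_mul]
  · simp

/-- In the top row of the minor only the last entry can be nonzero, so Laplace expansion along this
row leaves a single term. -/
theorem minorM_of_section {t : Matrix (Fin n) (Fin n) R} (ht : ∀ i j, j < i.rev → t i j = 0)
    (i j : Fin n) :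
    minorM t i j = (-1) ^ (n - (i + 1)) * (nextCorner t i).det * t i j := by
  have hs : n - (i + 1) + 1 = n - i := by omega
  rw [minorM, ← Matrix.det_submatrix_equiv_self (finCongr hs), Matrix.submatrix_submatrix,
    det_submatrix_of_row_zero]
  · have h1 : (⟨i + (finCongr hs 0 : Fin (n - i)), by omega⟩ : Fin n) = i :=
      Fin.ext (by simp)
    rw [Function.comp_apply, Function.comp_apply, h1, if_neg (by simp; omega)]
    rw [mul_right_comm]
    congr 3
    refine congrArg₂ t.submatrix ?_ ?_
    · funext r
      exact Fin.ext (by simp; omega)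
    · funext c
      simp only [Function.comp_apply]
      rw [if_pos (by simp; omega)]
      rfl
  · intro c hc
    have hc' : (c : ℕ) < n - (i + 1) := by
      have := Fin.val_ne_of_ne hc
      rw [Fin.val_last] at this
      omega
    have h1 : (⟨i + (finCongr hs 0 : Fin (n - i)), by omega⟩ : Fin n) = i :=
      Fin.ext (by simp)
    rw [Function.comp_apply, Function.comp_apply, h1, if_pos (by simp; omega)]
    exact ht _ _ (by rw [Fin.lt_def, Fin.val_rev]; simpa using hc')

/-- For j < k the first n - k entries of row j lie above the antidiagonal, so the minor has a zero
row. -/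
theorem matN_of_section {t : Matrix (Fin n) (Fin n) R} (ht : ∀ i j, j < i.rev → t i j = 0) :
    matN t = Matrix.diagonal (cornerD t) := by
  ext j k
  rcases lt_trichotomy j k with h | rfl | h
  · rw [Matrix.diagonal_apply_ne _ h.ne]
    refine Matrix.det_eq_zero_of_row_eq_zero ⟨0, by omega⟩ fun c => ?_
    rw [Matrix.submatrix_apply, if_pos rfl]
    refine ht _ _ ?_
    rw [Fin.lt_def] at h
    rw [Fin.lt_def, Fin.val_rev]
    simp only
    omega
  · rw [Matrix.diagonal_apply_eq]
    exact minorN_self t j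
  · rw [Matrix.diagonal_apply_ne _ h.ne']
    exact minorN_eq_zero t h

variable {L : Type*} [Field L]

theorem det_nextCorner_ne_zero {X : Matrix (Fin n) (Fin n) L} (hX : ∀ k, cornerD X k ≠ 0)
    (k : Fin n) : (nextCorner X k).det ≠ 0 := by
  rcases lt_or_ge ((k : ℕ) + 1) n with h | h
  · rw [det_nextCorner_of_lt _ h]
    exact hX _
  · rw [det_nextCorner_of_le _ h]
    exact one_ne_zero

/-- A matrix with nonzero corner minors becomes zero above the antidiagonal after multiplication
by a unitriangular matrix from the left. -/
theorem exists_isUnitriangular_mul {X : Matrix (Fin n) (Fin n) L} (hX : ∀ k, cornerD X k ≠ 0) :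
    ∃ w : Matrix (Fin n) (Fin n) L,
      IsUnitriangular w ∧ ∀ i j, j < i.rev → (w * X) i j = 0 := by
  -- Row i is cleared left of the antidiagonal by adding multiples of the rows below it; the linear
  -- system for the multipliers has the invertible matrix `nextCorner X i`.
  have hex : ∀ i : Fin n, ∃ a : Fin (n - (i + 1)) → L, ∀ c : Fin (n - (i + 1)),
      (a ᵥ* nextCorner X i) c = - X i ⟨c, by omega⟩ := fun i => by
    refine ⟨(fun c : Fin (n - (i + 1)) => - X i ⟨c, by omega⟩) ᵥ* (nextCorner X i)⁻¹, fun c => ?_⟩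
    rw [Matrix.vecMul_vecMul, Matrix.nonsing_inv_mul _ (det_nextCorner_ne_zero hX i).isUnit,
      Matrix.vecMul_one]
  choose a ha using hex
  let w : Matrix (Fin n) (Fin n) L := Matrix.of fun i =>
    Pi.single i 1 + ∑ r, a i r • Pi.single (⟨i + 1 + r, by omega⟩ : Fin n) 1
  have hw : ∀ i j, w i j = (Pi.single i 1 : Fin n → L) j +
      ∑ r, a i r * (Pi.single (⟨i + 1 + r, by omega⟩ : Fin n) 1 : Fin n → L) j := fun i j => by
    simp [w]
  have hw' : ∀ i j, j ≤ i → w i j = (Pi.single i 1 : Fin n → L) j := fun i j hij => by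
    rw [hw, Finset.sum_eq_zero, add_zero]
    intro r _
    rw [Pi.single_eq_of_ne, mul_zero]
    rw [Fin.le_def] at hij
    rw [ne_eq, Fin.ext_iff]
    simp only
    omega
  refine ⟨w, ⟨fun i j h => ?_, fun i => ?_⟩, fun i j h => ?_⟩
  · rw [hw' i j h.le, Pi.single_eq_of_ne h.ne]
  · rw [hw' i i le_rfl, Pi.single_eq_same]
  · rw [Fin.lt_def, Fin.val_rev] at h
    have hrow : (w * X) i = (Pi.single i 1 + ∑ r, a i r •
        Pi.single (⟨i + 1 + r, by omega⟩ : Fin n) 1 : Fin n → L) ᵥ* X := rfl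
    rw [hrow]
    simp only [Matrix.add_vecMul, Matrix.sum_vecMul, Matrix.smul_vecMul,
      Matrix.single_one_vecMul, Pi.add_apply, Finset.sum_apply, Pi.smul_apply, Matrix.row_apply,
      smul_eq_mul]
    have := ha i ⟨j, h⟩
    simp only [Matrix.vecMul, dotProduct, nextCorner, Matrix.submatrix_apply, Fin.eta] at this
    rw [this, add_neg_cancel]

theorem IsUnitriangular.mul_left_cancel {w A B : Matrix (Fin n) (Fin n) R}
    (hw : IsUnitriangular w) (h : w * A = w * B) : A = B := by
  have := congrArg (w.adjugate * ·) h
  simpa only [← Matrix.mul_assoc, hw.adjugate_mul, Matrix.one_mul] using this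

/-- A matrix with nonzero corner minors is recovered from its minors `N_{jk}`, `M_{ij}`. -/
theorem eq_matN_mul_matM {X : Matrix (Fin n) (Fin n) L} (hX : ∀ k, cornerD X k ≠ 0) :
    X = matN X * Matrix.diagonal (fun k => (cornerD X k)⁻¹ *
      ((-1) ^ (n - (k + 1)) * (nextCorner X k).det)⁻¹) * matM X := by
  obtain ⟨w, hw, ht⟩ := exists_isUnitriangular_mul hX
  have hN := matN_of_section ht
  rw [matN_mul_left hw, show cornerD (w * X) = cornerD X from
    funext fun k => cornerD_mul_left hw X k] at hN
  have hM : matM X = Matrix.diagonal (fun k : Fin n => (-1) ^ (n - (k + 1)) * (nextCorner X k).det) *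
      (w * X) := by
    rw [← matM_mul_left hw]
    ext i j
    rw [Matrix.diagonal_mul, ← det_nextCorner_mul_left hw]
    exact minorM_of_section ht i j
  -- After multiplication by w the N-factor is diagonal and the M-factor is a diagonal matrix times
  -- wX, so the three diagonal factors have to cancel.
  refine hw.mul_left_cancel ?_
  rw [← Matrix.mul_assoc, ← Matrix.mul_assoc, hN, hM, ← Matrix.mul_assoc,
    Matrix.diagonal_mul_diagonal, Matrix.diagonal_mul_diagonal]
  have h1 : (fun k => cornerD X k * ((cornerD X k)⁻¹ *
      ((-1) ^ (n - (k + 1)) * (nextCorner X k).det)⁻¹) *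
      ((-1) ^ (n - (k + 1)) * (nextCorner X k).det)) = fun _ : Fin n => (1 : L) := by
    funext k
    have h2 := hX k
    have h3 : (-1) ^ (n - (k + 1)) * (nextCorner X k).det ≠ 0 :=
      mul_ne_zero (pow_ne_zero _ (neg_ne_zero.mpr one_ne_zero)) (det_nextCorner_ne_zero hX k)
    rw [mul_inv_cancel_left₀ h2, inv_mul_cancel₀ h3]
  rw [h1, Matrix.diagonal_one, Matrix.one_mul]

theorem det_matN (X : Matrix (Fin n) (Fin n) R) : (matN X).det = ∏ k, cornerD X k := by
  rw [Matrix.det_of_isUpperTriangular (M := matN X) (fun i j h => minorN_eq_zero X h)]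
  exact Finset.prod_congr rfl fun k _ => minorN_self X k

/-- Reversing the order of the columns makes `matM X` lower triangular with the corner minors on the
diagonal. -/
theorem det_matM_ne_zero {X : Matrix (Fin n) (Fin n) L} (hX : ∀ k, cornerD X k ≠ 0) :
    (matM X).det ≠ 0 := by
  have h1 := Matrix.det_permute' Fin.revPerm (matM X)
  have h2 : ((matM X).submatrix id Fin.revPerm).det = ∏ k, cornerD X k := by
    rw [Matrix.det_of_isLowerTriangular]
    · exact Finset.prod_congr rfl fun k _ => minorM_rev X k
    · intro i j h
      exact minorM_eq_zero X (Fin.rev_lt_rev.mpr h)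
  intro h
  rw [h, mul_zero, h2] at h1
  exact Finset.prod_ne_zero_iff.mpr (fun k _ => hX k) h1

end Decomposition

/-! ### Conjugation to a normal form over the field of the generators -/

section Section

variable {K L : Type*} [Field K] [Field L] [Algebra K L] {n : ℕ}

/-- All entries of the matrix lie in the subfield `F`. -/
def EntriesIn (F : IntermediateField K L) (A : Matrix (Fin n) (Fin n) L) : Prop :=
  ∀ i j, A i j ∈ F

variable {F : IntermediateField K L}

theorem EntriesIn.mul {A B : Matrix (Fin n) (Fin n) L} (hA : EntriesIn F A) (hB : EntriesIn F B) :
    EntriesIn F (A * B) := fun i j => by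
  rw [Matrix.mul_apply]
  exact sum_mem fun k _ => mul_mem (hA i k) (hB k j)

theorem EntriesIn.diagonal {d : Fin n → L} (hd : ∀ i, d i ∈ F) :
    EntriesIn F (Matrix.diagonal d) := fun i j => by
  rw [Matrix.diagonal_apply]
  split_ifs
  · exact hd i
  · exact zero_mem F

theorem EntriesIn.adjugate {A : Matrix (Fin n) (Fin n) L} (hA : EntriesIn F A) :
    EntriesIn F A.adjugate := fun i j => by
  let B : Matrix (Fin n) (Fin n) F := Matrix.of fun i j => ⟨A i j, hA i j⟩
  have h : A = F.val.toRingHom.mapMatrix B := rfl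
  rw [h, ← RingHom.map_adjugate]
  exact (B.adjugate i j).2

theorem EntriesIn.det {A : Matrix (Fin n) (Fin n) L} (hA : EntriesIn F A) : A.det ∈ F := by
  let B : Matrix (Fin n) (Fin n) F := Matrix.of fun i j => ⟨A i j, hA i j⟩
  have h : A = F.val.toRingHom.mapMatrix B := rfl
  rw [h, ← RingHom.map_det]
  exact B.det.2

theorem EntriesIn.inv {A : Matrix (Fin n) (Fin n) L} (hA : EntriesIn F A) :
    EntriesIn F A⁻¹ := fun i j => by
  rw [Matrix.inv_def, Matrix.smul_apply, Ring.inverse_eq_inv', smul_eq_mul]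
  exact mul_mem (inv_mem hA.det) (hA.adjugate i j)

theorem entriesIn_matM_mul_matN {X Y : Matrix (Fin n) (Fin n) L} (hX : ∀ k, cornerD X k ∈ F)
    (hY : ∀ k, cornerD Y k ∈ F) (hP : ∀ i k, i.rev < k → mixedP X Y i k ∈ F) :
    EntriesIn F (matM X * matN Y) := fun i k => by
  rw [matM_mul_matN_apply]
  rcases lt_trichotomy i.rev k with h | rfl | h
  · exact hP i k h
  · rw [mixedP_rev]
    exact mul_mem (hX _) (hY _)
  · rw [mixedP_eq_zero _ _ h]
    exact zero_mem F

/-- A tuple of matrices can be conjugated by a unitriangular matrix to a tuple of matrices with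
entries in any field that contains all `P_{ik}(X_1, X_ℓ)`, `P_{ik}(X_ℓ)` and `D_k(X_ℓ)`. -/
theorem exists_conj_entriesIn {ι : Type*} (o : ι) (X : ι → Matrix (Fin n) (Fin n) L)
    (hX : ∀ ℓ k, cornerD (X ℓ) k ≠ 0) (hD : ∀ ℓ k, cornerD (X ℓ) k ∈ F)
    (hS : ∀ ℓ i k, i.rev < k → mixedP (X ℓ) (X ℓ) i k ∈ F)
    (hO : ∀ ℓ i k, i.rev < k → mixedP (X o) (X ℓ) i k ∈ F) :
    ∃ u, IsUnitriangular u ∧ ∀ ℓ, EntriesIn F (u.adjugate * X ℓ * u) := by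
  have hN : ∀ ℓ, IsUnit (matN (X ℓ)).det := fun ℓ => by
    rw [det_matN]
    exact (Finset.prod_ne_zero_iff.mpr fun k _ => hX ℓ k).isUnit
  have hM : IsUnit (matM (X o)).det := (det_matM_ne_zero (hX o)).isUnit
  let E : Matrix (Fin n) (Fin n) L := Matrix.diagonal fun k => (cornerD (X o) k)⁻¹
  have hE : EntriesIn F E := EntriesIn.diagonal fun k => inv_mem (hD o k)
  have hu : IsUnitriangular (matN (X o) * E) := by
    refine ⟨fun i j h => ?_, fun i => ?_⟩
    · rw [Matrix.mul_diagonal, show matN (X o) i j = 0 from minorN_eq_zero _ h, zero_mul]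
    · rw [Matrix.mul_diagonal, show matN (X o) i i = cornerD (X o) i from minorN_self _ i,
        mul_inv_cancel₀ (hX o i)]
  refine ⟨matN (X o) * E, hu, fun ℓ => ?_⟩
  have hSS := entriesIn_matM_mul_matN (hD ℓ) (hD ℓ) (hS ℓ)
  have hOO := entriesIn_matM_mul_matN (hD o) (hD o) (hS o)
  have hOS := entriesIn_matM_mul_matN (hD o) (hD ℓ) (hO ℓ)
  have hnext : ∀ k, (nextCorner (X ℓ) k).det ∈ F := fun k => by
    rcases lt_or_ge ((k : ℕ) + 1) n with h | h
    · rw [det_nextCorner_of_lt _ h]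
      exact hD ℓ _
    · rw [det_nextCorner_of_le _ h]
      exact one_mem F
  have hC : EntriesIn F (Matrix.diagonal fun k => (cornerD (X ℓ) k)⁻¹ *
      ((-1) ^ (n - (k + 1)) * (nextCorner (X ℓ) k).det)⁻¹ : Matrix (Fin n) (Fin n) L) :=
    EntriesIn.diagonal fun k => mul_mem (inv_mem (hD ℓ k))
      (inv_mem (mul_mem (pow_mem (neg_mem (one_mem F)) _) (hnext k)))
  obtain ⟨C, hC, hXC⟩ : ∃ C, EntriesIn F C ∧ X ℓ = matN (X ℓ) * C * matM (X ℓ) :=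
    ⟨_, hC, eq_matN_mul_matM (hX ℓ)⟩
  -- M(X_o) is inserted between the two factors, so that only invariant products remain.
  have h1 : (matN (X o) * E)⁻¹ * matN (X ℓ) =
      E⁻¹ * ((matM (X o) * matN (X o))⁻¹ * (matM (X o) * matN (X ℓ))) := by
    rw [Matrix.mul_inv_rev, Matrix.mul_inv_rev, Matrix.mul_assoc, Matrix.mul_assoc,
      Matrix.nonsing_inv_mul_cancel_left _ _ hM]
  -- M(X_ℓ)N(X_o) itself is not available from the hypotheses; it is rewritten through the products
  -- M(X_ℓ)N(X_ℓ), M(X_o)N(X_ℓ) and M(X_o)N(X_o).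
  have h2 : matM (X ℓ) * (matN (X o) * E) =
      (matM (X ℓ) * matN (X ℓ)) * ((matM (X o) * matN (X ℓ))⁻¹ * (matM (X o) * matN (X o))) *
        E := by
    rw [Matrix.mul_inv_rev, Matrix.mul_assoc (matN (X ℓ))⁻¹,
      Matrix.nonsing_inv_mul_cancel_left _ _ hM, Matrix.mul_assoc (matM (X ℓ)),
      Matrix.mul_nonsing_inv_cancel_left _ _ (hN ℓ), Matrix.mul_assoc]
  have h3 : (matN (X o) * E)⁻¹ * X ℓ * (matN (X o) * E) =
      ((matN (X o) * E)⁻¹ * matN (X ℓ)) * C * (matM (X ℓ) * (matN (X o) * E)) := by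
    refine (congrArg (fun Y => (matN (X o) * E)⁻¹ * Y * (matN (X o) * E)) hXC).trans ?_
    simp only [Matrix.mul_assoc]
  rw [← Matrix.inv_eq_left_inv hu.adjugate_mul, h3, h1, h2]
  exact ((hE.inv.mul (hOO.inv.mul hOS)).mul hC).mul ((hSS.mul (hOS.inv.mul hOO)).mul hE)

end Section

/-! ### Evaluation at conjugated tuples and extension of invariance -/

section Evaluation

variable {K : Type*} [Field K] {n m : ℕ}

/-- The value of a polynomial function on a tuple of matrices over a `K`-algebra. -/
noncomputable def evalTuple (K : Type*) [Field K] {A : Type*} [CommRing A] [Algebra K A]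
    (Y : Fin m → Matrix (Fin n) (Fin n) A) : CoordRing K n m →ₐ[K] A :=
  MvPolynomial.aeval fun v => Y v.1 v.2.1 v.2.2

theorem map_evalTuple {A B : Type*} [CommRing A] [Algebra K A] [CommRing B] [Algebra K B]
    (f : A →ₐ[K] B) (Y : Fin m → Matrix (Fin n) (Fin n) A) (p : CoordRing K n m) :
    f (evalTuple K Y p) = evalTuple K (fun ℓ => (Y ℓ).map f) p := by
  rw [evalTuple, ← AlgHom.comp_apply, MvPolynomial.comp_aeval]
  rfl

/-- The unitriangular matrix with given entries above the diagonal. -/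
def unitriOf {R : Type*} [CommRing R] (x : Fin n × Fin n → R) : Matrix (Fin n) (Fin n) R :=
  Matrix.of fun i j => if i < j then x (i, j) else if i = j then 1 else 0

theorem isUnitriangular_unitriOf {R : Type*} [CommRing R] (x : Fin n × Fin n → R) :
    IsUnitriangular (unitriOf x) :=
  ⟨fun i j h => by simp [unitriOf, h.not_gt, h.ne'], fun i => by simp [unitriOf]⟩

theorem IsUnitriangular.eq_unitriOf {R : Type*} [CommRing R] {g : Matrix (Fin n) (Fin n) R}
    (hg : IsUnitriangular g) : g = unitriOf fun v => g v.1 v.2 := by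
  ext i j
  simp only [unitriOf, Matrix.of_apply]
  split_ifs with h1 h2
  · rfl
  · rw [h2, hg.2]
  · exact hg.1 i j (lt_of_le_of_ne (not_lt.mp h1) (Ne.symm h2))

theorem map_unitriOf {R S : Type*} [CommRing R] [CommRing S] (f : R →+* S)
    (x : Fin n × Fin n → R) : (unitriOf x).map f = unitriOf fun v => f (x v) := by
  ext i j
  simp only [unitriOf, Matrix.of_apply, Matrix.map_apply]
  split_ifs <;> simp

theorem IsUnitriangular.adjugate {R : Type*} [CommRing R] {g : Matrix (Fin n) (Fin n) R}
    (hg : IsUnitriangular g) : IsUnitriangular g.adjugate := by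
  have h0 : ∀ i j, j < i → g.adjugate i j = 0 := by
    intro i j h
    let _ : Invertible g := ⟨g.adjugate, hg.adjugate_mul, hg.mul_adjugate⟩
    have := Matrix.blockTriangular_inv_of_blockTriangular
      (M := g) (b := id) (fun i j h => hg.1 i j h)
    rw [Matrix.inv_eq_left_inv hg.adjugate_mul] at this
    exact this h
  refine ⟨h0, fun i => ?_⟩
  have h1 := congrFun (congrFun hg.mul_adjugate i) i
  rw [Matrix.mul_apply, Finset.sum_eq_single i, hg.2, one_mul, Matrix.one_apply_eq] at h1
  · exact h1
  · intro k _ hk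
    rcases lt_or_gt_of_ne hk with hk | hk
    · rw [hg.1 i k hk, zero_mul]
    · rw [h0 k i hk, mul_zero]
  · simp

theorem map_conj {R S : Type*} [CommRing R] [CommRing S] (f : R →+* S)
    (g X : Matrix (Fin n) (Fin n) R) :
    (g.adjugate * X * g).map f = (g.map f).adjugate * X.map f * g.map f := by
  rw [Matrix.map_mul, Matrix.map_mul]
  exact congrArg (· * X.map f * g.map f) (RingHom.map_adjugate f g)

/-- The tuple of matrices conjugated by the generic unitriangular matrix. -/
noncomputable def genericConj {L : Type*} [CommRing L] (X : Fin m → Matrix (Fin n) (Fin n) L)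
    (ℓ : Fin m) : Matrix (Fin n) (Fin n) (MvPolynomial (Fin n × Fin n) L) :=
  (unitriOf MvPolynomial.X).adjugate * (X ℓ).map MvPolynomial.C * unitriOf MvPolynomial.X

theorem aeval_evalTuple_genericConj {L B : Type*} [CommRing L] [Algebra K L] [CommRing B]
    [Algebra L B] [Algebra K B] [IsScalarTower K L B] (X : Fin m → Matrix (Fin n) (Fin n) L)
    (x : Fin n × Fin n → B) (p : CoordRing K n m) :
    MvPolynomial.aeval x (evalTuple K (genericConj X) p) =
      evalTuple K (fun ℓ => (unitriOf x).adjugate * (X ℓ).map (algebraMap L B) * unitriOf x) p := by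
  refine (map_evalTuple ((MvPolynomial.aeval (R := L) x).restrictScalars K) _ p).trans ?_
  congr 2
  funext ℓ
  refine (map_conj (MvPolynomial.aeval (R := L) x).toRingHom _ _).trans ?_
  have h1 : (unitriOf MvPolynomial.X).map (MvPolynomial.aeval (R := L) x).toRingHom =
      unitriOf x := by
    rw [map_unitriOf]
    congr 1
    funext v
    exact MvPolynomial.aeval_X x v
  have h2 : ((X ℓ).map MvPolynomial.C).map (MvPolynomial.aeval (R := L) x).toRingHom =
      (X ℓ).map (algebraMap L B) := by
    ext i j
    exact MvPolynomial.aeval_C x _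
  rw [h1, h2]

/-- An invariance property over an infinite field extends to all unitriangular matrices with
entries in commutative algebras. -/
theorem evalTuple_conj_of_infinite {k L : Type*} [Field k] [Infinite k] [Field L] [Algebra k L]
    [Algebra K L] (X : Fin m → Matrix (Fin n) (Fin n) L) (a b : CoordRing K n m)
    (hab : ∀ g : Matrix (Fin n) (Fin n) k, IsUnitriangular g →
      evalTuple K X a * evalTuple K (fun ℓ => (g.map (algebraMap k L)).adjugate * X ℓ *
        g.map (algebraMap k L)) b =
      evalTuple K X b * evalTuple K (fun ℓ => (g.map (algebraMap k L)).adjugate * X ℓ *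
        g.map (algebraMap k L)) a)
    {A : Type*} [CommRing A] [Algebra L A] [Algebra K A] [IsScalarTower K L A]
    {h : Matrix (Fin n) (Fin n) A} (hh : IsUnitriangular h) :
    algebraMap L A (evalTuple K X a) *
        evalTuple K (fun ℓ => h.adjugate * (X ℓ).map (algebraMap L A) * h) b =
      algebraMap L A (evalTuple K X b) *
        evalTuple K (fun ℓ => h.adjugate * (X ℓ).map (algebraMap L A) * h) a := by
  -- The identity for the generic unitriangular matrix: both sides are polynomials in its entries
  -- that agree on all points with coordinates in the infinite image of k. Every other case is a
  -- specialization of it.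
  have key : MvPolynomial.C (evalTuple K X a) * evalTuple K (genericConj X) b =
      MvPolynomial.C (evalTuple K X b) * evalTuple K (genericConj X) a := by
    refine MvPolynomial.funext_set (fun _ => Set.range (algebraMap k L))
      (fun _ => Set.infinite_range_of_injective (algebraMap k L).injective) fun x hx => ?_
    choose y hy using fun v => hx v (Set.mem_univ v)
    have hx' : unitriOf x = (unitriOf y).map (algebraMap k L) := by
      rw [map_unitriOf]
      exact congrArg unitriOf (funext fun v => (hy v).symm)
    have h1 := hab (unitriOf y) (isUnitriangular_unitriOf y)
    rw [← hx'] at h1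
    have h2 : ∀ p, MvPolynomial.eval x (evalTuple K (genericConj X) p) = evalTuple K (fun ℓ =>
        (unitriOf x).adjugate * X ℓ * unitriOf x) p := fun p => by
      rw [← MvPolynomial.coe_aeval_eq_eval]
      exact aeval_evalTuple_genericConj X x p
    rw [map_mul, map_mul, MvPolynomial.eval_C, MvPolynomial.eval_C, h2, h2, h1]
  have h1 := congrArg (MvPolynomial.aeval fun v : Fin n × Fin n => h v.1 v.2) key
  have h2 := fun p => aeval_evalTuple_genericConj (K := K) X (fun v => h v.1 v.2) p
  rw [← hh.eq_unitriOf] at h2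
  rw [map_mul, map_mul, MvPolynomial.aeval_C, MvPolynomial.aeval_C] at h1
  rwa [h2, h2] at h1

/-- The matrices lift to F[τ], and a polynomial with coefficients in K can be evaluated there. -/
theorem coeff_evalTuple_mem {L : Type*} [Field L] [Algebra K L] (F : IntermediateField K L)
    {τ : Type*} (Y : Fin m → Matrix (Fin n) (Fin n) (MvPolynomial τ L))
    (hY : ∀ ℓ i j, Y ℓ i j ∈ (MvPolynomial.map F.val.toRingHom : MvPolynomial τ F →+* _).range)
    (p : CoordRing K n m) (d : τ →₀ ℕ) : (evalTuple K Y p).coeff d ∈ F := by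
  choose Y0 hY0 using hY
  have h1 := map_evalTuple (MvPolynomial.mapAlgHom (σ := τ) F.val) (fun ℓ => Matrix.of (Y0 ℓ)) p
  have h2 : (fun ℓ => (Matrix.of (Y0 ℓ)).map (MvPolynomial.mapAlgHom (σ := τ) F.val)) = Y := by
    funext ℓ
    ext1 i j
    exact hY0 ℓ i j
  rw [h2] at h1
  rw [← h1, MvPolynomial.mapAlgHom_apply, MvPolynomial.coeff_map]
  exact SetLike.coe_mem _

/-- A rational function that is invariant in the sense of `evalTuple_conj_of_infinite` takes its
value in any field over which the tuple of matrices is unitriangularly conjugate to a tuple with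
entries in this field. -/
theorem evalTuple_div_mem {L : Type*} [Field L] [Algebra K L] (F : IntermediateField K L)
    (X : Fin m → Matrix (Fin n) (Fin n) L) {u : Matrix (Fin n) (Fin n) L}
    (hu : IsUnitriangular u) (huF : ∀ ℓ, EntriesIn F (u.adjugate * X ℓ * u))
    {a b : CoordRing K n m} (hb : evalTuple K X b ≠ 0)
    (hab : ∀ h : Matrix (Fin n) (Fin n) (MvPolynomial (Fin n × Fin n) L), IsUnitriangular h →
      MvPolynomial.C (evalTuple K X a) *
        evalTuple K (fun ℓ => h.adjugate * (X ℓ).map MvPolynomial.C * h) b =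
      MvPolynomial.C (evalTuple K X b) *
        evalTuple K (fun ℓ => h.adjugate * (X ℓ).map MvPolynomial.C * h) a) :
    evalTuple K X a / evalTuple K X b ∈ F := by
  let Z : Fin m → Matrix (Fin n) (Fin n) L := fun ℓ => u.adjugate * X ℓ * u
  have hW : (fun ℓ => (u.map MvPolynomial.C * unitriOf MvPolynomial.X).adjugate *
      (X ℓ).map MvPolynomial.C * (u.map MvPolynomial.C * unitriOf MvPolynomial.X)) = genericConj Z := by
    funext ℓ
    simp only [genericConj, Z]
    rw [map_conj, Matrix.adjugate_mul_distrib]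
    simp only [Matrix.mul_assoc]
  -- Conjugation by u followed by a generic unitriangular matrix, instead of u alone, keeps the
  -- value of the denominator nonzero.
  have h1 := hab _ ((hu.map MvPolynomial.C).mul (isUnitriangular_unitriOf MvPolynomial.X))
  rw [hW] at h1
  have hcoeff : ∀ p d, (evalTuple K (genericConj Z) p).coeff d ∈ F := by
    refine coeff_evalTuple_mem F (genericConj Z) fun ℓ => ?_
    let G0 : Matrix (Fin n) (Fin n) (MvPolynomial (Fin n × Fin n) F) := unitriOf MvPolynomial.X
    let Z0 : Matrix (Fin n) (Fin n) F := Matrix.of fun i j => ⟨_, huF ℓ i j⟩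
    have hG : G0.map (MvPolynomial.map F.val.toRingHom) =
        unitriOf (MvPolynomial.X : _ → MvPolynomial (Fin n × Fin n) L) := by
      rw [map_unitriOf]
      congr 1
      funext v
      exact MvPolynomial.map_X _ v
    have hZ : (Z0.map MvPolynomial.C).map (MvPolynomial.map F.val.toRingHom) =
        (u.adjugate * X ℓ * u).map (MvPolynomial.C (σ := Fin n × Fin n)) := by
      ext1 i j
      exact MvPolynomial.map_C _ _
    have h2 := map_conj (MvPolynomial.map F.val.toRingHom) G0 (Z0.map MvPolynomial.C)
    rw [hG, hZ] at h2
    exact fun i j => ⟨_, congrFun (congrFun h2 i) j⟩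
  have hne : evalTuple K (genericConj Z) b ≠ 0 := by
    intro h0
    -- Specializing the generic matrix to the inverse of u undoes the conjugation and returns the
    -- value of b at X, which is nonzero.
    have h2 := aeval_evalTuple_genericConj (K := K) Z (fun v => u.adjugate v.1 v.2) b
    rw [h0, map_zero, ← hu.adjugate.eq_unitriOf] at h2
    refine hb (Eq.trans ?_ h2.symm)
    congr 2
    funext ℓ
    change _ = u.adjugate.adjugate * (u.adjugate * X ℓ * u) * u.adjugate
    rw [← Matrix.mul_assoc, ← Matrix.mul_assoc, hu.adjugate.adjugate_mul, Matrix.one_mul,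
      Matrix.mul_assoc, hu.mul_adjugate, Matrix.mul_one]
  -- At any monomial where the denominator has a nonzero coefficient, the ratio of coefficients is
  -- the value sought.
  obtain ⟨d, hd⟩ := MvPolynomial.ne_zero_iff.mp hne
  have h2 := congrArg (MvPolynomial.coeff d) h1
  rw [MvPolynomial.coeff_C_mul, MvPolynomial.coeff_C_mul] at h2
  rw [show evalTuple K X a / evalTuple K X b =
    (evalTuple K (genericConj Z) a).coeff d / (evalTuple K (genericConj Z) b).coeff d by
      rw [div_eq_div_iff hb hd, h2, mul_comm]]
  exact div_mem (hcoeff a d) (hcoeff b d)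

end Evaluation

/-! ### Invariance of the generators and the generic normal form -/

section Generators

variable {K : Type*} [Field K] {n m : ℕ}

/-- The matrix `X_ℓ` of coordinate functions, over the field `K(H)`. -/
noncomputable def genericMatrixField (K : Type*) [Field K] (n m : ℕ) (ℓ : Fin m) :
    Matrix (Fin n) (Fin n) (FunctionField K n m) :=
  (genericMatrix K n m ℓ).map (algebraMap (CoordRing K n m) (FunctionField K n m))

theorem isUnitriangular_of_mem {g : Matrix.GeneralLinearGroup (Fin n) K}
    (hg : g ∈ unitriangular K n) : IsUnitriangular (g : Matrix (Fin n) (Fin n) K) := hg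

theorem conjSubst_genPoly [NeZero m] {g : Matrix.GeneralLinearGroup (Fin n) K}
    (hg : g ∈ unitriangular K n) (a : GenIndex n m) :
    conjSubst m g (genPoly K n m a) = genPoly K n m a := by
  have h1 : IsUnitriangular (constMatrix m (g : Matrix (Fin n) (Fin n) K)) :=
    (isUnitriangular_of_mem hg).map MvPolynomial.C
  have h2 : IsUnitriangular (constMatrix m ((g⁻¹ : Matrix.GeneralLinearGroup (Fin n) K) :
      Matrix (Fin n) (Fin n) K)) :=
    (isUnitriangular_of_mem (inv_mem hg)).map MvPolynomial.C
  have h3 : constMatrix m (g : Matrix (Fin n) (Fin n) K) *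
      constMatrix m ((g⁻¹ : Matrix.GeneralLinearGroup (Fin n) K) :
        Matrix (Fin n) (Fin n) K) = 1 := by
    rw [← constMatrix_mul, Units.mul_inv]
    exact Matrix.map_one _ MvPolynomial.C.map_zero MvPolynomial.C.map_one
  have hP : ∀ ℓ ℓ' i k, conjSubst m g (mixedP (genericMatrix K n m ℓ) (genericMatrix K n m ℓ') i k) =
      mixedP (genericMatrix K n m ℓ) (genericMatrix K n m ℓ') i k := fun ℓ ℓ' i k => by
    have h4 := map_mixedP (conjSubst m g).toRingHom (genericMatrix K n m ℓ)
      (genericMatrix K n m ℓ') i k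
    refine h4.symm.trans ?_
    have h5 := map_genericMatrix g ℓ
    have h6 := map_genericMatrix g ℓ'
    refine (congrArg₂ (fun A B => mixedP A B i k) h5 h6).trans ?_
    exact mixedP_conj h2 h1 h3 _ _ i k
  cases a with
  | mixed ℓ p => exact hP _ _ _ _
  | single ℓ p => exact hP _ _ _ _
  | corner ℓ k =>
    refine (map_cornerD (conjSubst m g).toRingHom (genericMatrix K n m ℓ) k).symm.trans ?_
    refine (congrArg (fun A => cornerD A k) (map_genericMatrix g ℓ)).trans ?_
    exact cornerD_conj h2 h1 _ k

theorem rho_algebraMap (g : Matrix.GeneralLinearGroup (Fin n) K) (p : CoordRing K n m) :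
    rho K n m g (algebraMap _ _ p) = algebraMap _ _ (conjSubst m g p) :=
  IsFractionRing.fieldEquivOfAlgEquiv_algebraMap K (FunctionField K n m) (FunctionField K n m)
    (rhoPoly K n m g) p

theorem mem_pointInvariants {f : FunctionField K n m} :
    f ∈ pointInvariants K n m ↔ ∀ g ∈ unitriangular K n, rho K n m g f = f := by
  rw [pointInvariants, IntermediateField.mem_fixedField_iff]
  refine ⟨fun h g hg => h _ ⟨g, hg, rfl⟩, ?_⟩
  rintro h _ ⟨g, hg, rfl⟩
  exact h g hg

theorem gen_mem_pointInvariants [NeZero m] (a : GenIndex n m) :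
    gen K n m a ∈ pointInvariants K n m := by
  rw [mem_pointInvariants]
  intro g hg
  rw [gen, rho_algebraMap, conjSubst_genPoly hg]

theorem extendScalars_algebraMap {L : Type*} [Field L] [Algebra K L] (p : CoordRing K n m) :
    extendScalars K L n m (algebraMap _ _ p) =
      algebraMap _ _ (MvPolynomial.map (algebraMap K L) p) := by
  rw [extendScalars, IsFractionRing.liftAlgHom_apply, IsFractionRing.lift_algebraMap]
  rfl

theorem map_genericMatrix_algebraMap {L : Type*} [Field L] [Algebra K L] (ℓ : Fin m) :
    (genericMatrix K n m ℓ).map (MvPolynomial.map (algebraMap K L)) = genericMatrix L n m ℓ := by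
  ext1 i j
  exact MvPolynomial.map_X _ _

theorem map_genPoly {L : Type*} [Field L] [Algebra K L] [NeZero m] (a : GenIndex n m) :
    MvPolynomial.map (algebraMap K L) (genPoly K n m a) = genPoly L n m a := by
  cases a <;> simp only [genPoly, ← map_mixedP, ← map_cornerD, map_genericMatrix_algebraMap]

theorem extendScalars_gen {L : Type*} [Field L] [Algebra K L] [NeZero m] (a : GenIndex n m) :
    extendScalars K L n m (gen K n m a) = gen L n m a := by
  rw [gen, extendScalars_algebraMap, map_genPoly, gen]

theorem extendScalars_self (f : FunctionField K n m) : extendScalars K K n m f = f := by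
  obtain ⟨a, b, -, rfl⟩ := IsFractionRing.div_surjective (CoordRing K n m) f
  have h : ∀ p : CoordRing K n m, MvPolynomial.map (algebraMap K K) p = p := MvPolynomial.map_id
  rw [map_div₀, extendScalars_algebraMap, extendScalars_algebraMap, h, h]

theorem gen_mem_groupInvariants [NeZero m] (a : GenIndex n m) :
    gen K n m a ∈ groupInvariants K n m := by
  change extendScalars K (AlgebraicClosure K) n m (gen K n m a) ∈
    pointInvariants (AlgebraicClosure K) n m
  rw [extendScalars_gen]
  exact gen_mem_pointInvariants a

theorem cornerD_genericMatrix_ne_zero (ℓ : Fin m) (k : Fin n) :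
    cornerD (genericMatrix K n m ℓ) k ≠ 0 := by
  intro h
  -- The chosen point is a shifted identity matrix, whose lower left corner of order n - k is the
  -- identity.
  have h1 := map_cornerD (MvPolynomial.eval fun v : Fin m × Fin n × Fin n =>
    if (v.2.1 : ℕ) = k + v.2.2 then (1 : K) else 0) (genericMatrix K n m ℓ) k
  rw [h, map_zero, cornerD] at h1
  refine one_ne_zero (α := K) (Eq.trans ?_ h1)
  rw [← Matrix.det_one (n := Fin (n - k))]
  congr 1
  ext r c
  simp [genericMatrix, Matrix.one_apply, Fin.ext_iff]

/-- The subfield generated by the system of generators. -/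
noncomputable def genField (K : Type*) [Field K] (n m : ℕ) [NeZero m] :
    IntermediateField K (FunctionField K n m) :=
  IntermediateField.adjoin K (Set.range (gen K n m))

theorem gen_mem_genField [NeZero m] (a : GenIndex n m) : gen K n m a ∈ genField K n m :=
  IntermediateField.subset_adjoin K _ ⟨a, rfl⟩

theorem exists_conj_entriesIn_genField (K : Type*) [Field K] (n m : ℕ) [NeZero m] :
    ∃ u, IsUnitriangular u ∧ ∀ ℓ,
      EntriesIn (genField K n m) (u.adjugate * genericMatrixField K n m ℓ * u) := by
  have hS : ∀ (ℓ : Fin m) (i k : Fin n), i.rev < k →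
      mixedP (genericMatrixField K n m ℓ) (genericMatrixField K n m ℓ) i k ∈ genField K n m := by
    intro ℓ i k h
    rw [genericMatrixField, map_mixedP]
    exact gen_mem_genField (.single ℓ ⟨(i, k), h⟩)
  refine exists_conj_entriesIn (0 : Fin m) _ (fun ℓ k => ?_) (fun ℓ k => ?_) hS fun ℓ i k h => ?_
  · rw [genericMatrixField, map_cornerD]
    exact (map_ne_zero_iff _ (IsFractionRing.injective (CoordRing K n m) (FunctionField K n m))).mpr
      (cornerD_genericMatrix_ne_zero ℓ k)
  · rw [genericMatrixField, map_cornerD]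
    exact gen_mem_genField (.corner ℓ k)
  · rcases eq_or_ne ℓ 0 with rfl | hℓ
    · exact hS _ i k h
    · rw [genericMatrixField, genericMatrixField, map_mixedP]
      exact gen_mem_genField (.mixed ⟨ℓ, hℓ⟩ ⟨(i, k), h⟩)

end Generators

/-! ### The generators generate the fields of invariants -/

section Generation

variable {K : Type*} [Field K] {n m : ℕ}

theorem algebraMap_eq_evalTuple (p : CoordRing K n m) :
    algebraMap (CoordRing K n m) (FunctionField K n m) p = evalTuple K (genericMatrixField K n m) p := by
  have h : IsScalarTower.toAlgHom K (CoordRing K n m) (FunctionField K n m) =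
      evalTuple K (genericMatrixField K n m) := by
    refine MvPolynomial.algHom_ext fun v => ?_
    exact (MvPolynomial.aeval_X (R := K)
      (fun v => genericMatrixField K n m v.1 v.2.1 v.2.2) v).symm
  exact DFunLike.congr_fun h p

theorem extendScalars_algebraMap_eq_evalTuple {k : Type*} [Field k] [Algebra K k]
    (p : CoordRing K n m) :
    extendScalars K k n m (algebraMap _ _ p) = evalTuple K (genericMatrixField k n m) p := by
  rw [algebraMap_eq_evalTuple, map_evalTuple]
  congr 2
  funext ℓ
  ext1 i j
  refine (extendScalars_algebraMap _).trans ?_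
  exact congrArg _ (MvPolynomial.map_X _ _)

theorem rho_evalTuple {k : Type*} [Field k] [Algebra K k] {g : Matrix.GeneralLinearGroup (Fin n) k}
    (hg : g ∈ unitriangular k n) (p : CoordRing K n m) :
    rho k n m g (evalTuple K (genericMatrixField k n m) p) =
      evalTuple K (fun ℓ => ((g : Matrix (Fin n) (Fin n) k).map
        (algebraMap k (FunctionField k n m))).adjugate * genericMatrixField k n m ℓ *
        (g : Matrix (Fin n) (Fin n) k).map (algebraMap k (FunctionField k n m))) p := by
  refine (map_evalTuple ((rho k n m g).toAlgHom.restrictScalars K) _ p).trans ?_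
  congr 2
  funext ℓ
  have h1 : (genericMatrixField k n m ℓ).map (rho k n m g) =
      ((genericMatrix k n m ℓ).map (conjSubst m g)).map
        (algebraMap (CoordRing k n m) (FunctionField k n m)) := by
    ext1 i j
    exact rho_algebraMap g _
  have h2 : ∀ A : Matrix (Fin n) (Fin n) k, (constMatrix m A).map
      (algebraMap (CoordRing k n m) (FunctionField k n m)) =
        A.map (algebraMap k (FunctionField k n m)) := fun A => by
    ext1 i j
    exact (IsScalarTower.algebraMap_apply k (CoordRing k n m) (FunctionField k n m) _).symm
  have hu : IsUnitriangular (g : Matrix (Fin n) (Fin n) k) := hg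
  have h3 : ((g⁻¹ : Matrix.GeneralLinearGroup (Fin n) k) : Matrix (Fin n) (Fin n) k) =
      (g : Matrix (Fin n) (Fin n) k).adjugate := by
    rw [Matrix.coe_units_inv, Matrix.inv_eq_left_inv hu.adjugate_mul]
  refine h1.trans ?_
  rw [map_genericMatrix, Matrix.map_mul, Matrix.map_mul, h2, h2, h3]
  congr 2
  exact RingHom.map_adjugate (algebraMap k (FunctionField k n m)) _

/-- A rational function over `K` whose image over an infinite extension `k` of `K` is invariant
under the unitriangular matrices over `k` belongs to the field generated by the system. -/
theorem mem_genField_of_extendScalars_mem {k : Type*} [Field k] [Infinite k] [Algebra K k]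
    [NeZero m] {f : FunctionField K n m}
    (hf : extendScalars K k n m f ∈ pointInvariants k n m) : f ∈ genField K n m := by
  obtain ⟨a, b, hb, rfl⟩ := IsFractionRing.div_surjective (CoordRing K n m) f
  rw [mem_pointInvariants] at hf
  let e := extendScalars K k n m
  have hb0 : algebraMap (CoordRing K n m) (FunctionField K n m) b ≠ 0 :=
    IsFractionRing.to_map_ne_zero_of_mem_nonZeroDivisors hb
  have he : ∀ p : CoordRing K n m, e (algebraMap _ _ p) =
      evalTuple K (genericMatrixField k n m) p := extendScalars_algebraMap_eq_evalTuple
  have hb1 : evalTuple K (genericMatrixField k n m) b ≠ 0 := by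
    rw [← he]
    exact (map_ne_zero_iff _ e.injective).mpr hb0
  obtain ⟨u, hu, huF⟩ := exists_conj_entriesIn_genField K n m
  have hue : IsUnitriangular (u.map e) := hu.map e.toRingHom
  have hX : ∀ ℓ, (genericMatrixField K n m ℓ).map e = genericMatrixField k n m ℓ := fun ℓ => by
    ext1 i j
    refine (extendScalars_algebraMap _).trans ?_
    exact congrArg _ (MvPolynomial.map_X _ _)
  -- The matrix u is found over K(H) and only then carried into k(H). The target is thus the image
  -- of the field generated over K, not over k, and injectivity of `e` brings membership back.
  have hueF : ∀ ℓ, EntriesIn ((genField K n m).map e)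
      ((u.map e).adjugate * genericMatrixField k n m ℓ * u.map e) := fun ℓ i j => by
    have h1 := map_conj e.toRingHom u (genericMatrixField K n m ℓ)
    have h2 : (genericMatrixField K n m ℓ).map e.toRingHom = genericMatrixField k n m ℓ := hX ℓ
    rw [h2] at h1
    exact ⟨_, huF ℓ i j, congrFun (congrFun h1 i) j⟩
  have key := evalTuple_div_mem ((genField K n m).map e) (genericMatrixField k n m) hue hueF
    (a := a) hb1 fun h hh => evalTuple_conj_of_infinite (k := k) _ a b (fun g hg => ?_) hh
  · rw [← he, ← he, ← map_div₀] at key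
    obtain ⟨y, hy, hye⟩ := key
    have := e.injective hye
    rwa [← this]
  · let g' : Matrix.GeneralLinearGroup (Fin n) k :=
      ⟨g, g.adjugate, hg.mul_adjugate, hg.adjugate_mul⟩
    have h1 := hf g' hg
    rw [map_div₀, map_div₀] at h1
    change rho k n m g' (e _) / rho k n m g' (e _) = e _ / e _ at h1
    rw [he, he] at h1
    have h2 : rho k n m g' (evalTuple K (genericMatrixField k n m) b) ≠ 0 :=
      (map_ne_zero_iff _ (rho k n m g').injective).mpr hb1
    rw [div_eq_div_iff h2 hb1, rho_evalTuple (g := g') hg, rho_evalTuple (g := g') hg] at h1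
    rw [← h1, mul_comm]

theorem genField_eq_groupInvariants (K : Type*) [Field K] (n m : ℕ) [NeZero m] :
    genField K n m = groupInvariants K n m := by
  refine le_antisymm (IntermediateField.adjoin_le_iff.mpr ?_) fun f hf => ?_
  · rintro _ ⟨a, rfl⟩
    exact gen_mem_groupInvariants a
  · have : Infinite (AlgebraicClosure K) := IsAlgClosed.instInfinite
    exact mem_genField_of_extendScalars_mem (k := AlgebraicClosure K) hf

theorem genField_eq_pointInvariants (K : Type*) [Field K] [Infinite K] (n m : ℕ) [NeZero m] :
    genField K n m = pointInvariants K n m := by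
  refine le_antisymm (IntermediateField.adjoin_le_iff.mpr ?_) fun f hf => ?_
  · rintro _ ⟨a, rfl⟩
    exact gen_mem_pointInvariants a
  · exact mem_genField_of_extendScalars_mem (k := K) (by rwa [extendScalars_self])

end Generation

/-! ### Algebraic independence by counting -/

section Independence

variable {K : Type*} [Field K] {n m : ℕ}

/-- An injection of the labels of the generators and of the positions above the diagonal into the
set of coordinates. -/
def labelToCoord [NeZero m] :
    GenIndex n m ⊕ {p : Fin n × Fin n // p.1 < p.2} → Fin m × Fin n × Fin n
  | .inl (.mixed ℓ p) => (ℓ.1, p.1.1.rev, p.1.2)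
  | .inl (.single ℓ p) => (ℓ, p.1.2, p.1.1.rev)
  | .inl (.corner ℓ k) => (ℓ, k, k)
  | .inr p => (0, p.1.1, p.1.2)

/-- Since i' < k, mixed labels go above the diagonal in the matrices other than the first, single
labels below it, and corner labels onto it; the positions above the diagonal of the first matrix are
left for the entries of u. -/
theorem labelToCoord_injective [NeZero m] :
    Function.Injective (labelToCoord (n := n) (m := m)) := by
  rintro ((⟨⟨ℓ, hℓ⟩, ⟨⟨i, k⟩, h⟩⟩ | ⟨ℓ, ⟨⟨i, k⟩, h⟩⟩ | ⟨ℓ, k⟩) | ⟨⟨i, k⟩, h⟩)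
    ((⟨⟨ℓ', hℓ'⟩, ⟨⟨i', k'⟩, h'⟩⟩ | ⟨ℓ', ⟨⟨i', k'⟩, h'⟩⟩ | ⟨ℓ', k'⟩) | ⟨⟨i', k'⟩, h'⟩) hab <;>
  simp only [labelToCoord, Prod.mk.injEq] at * <;> grind [Fin.rev_inj]

theorem isAlgebraic_adjoin_of_intermediateField_adjoin_eq_top {L : Type*} [Field L] [Algebra K L]
    {S : Set L} (hS : IntermediateField.adjoin K S = ⊤) :
    Algebra.IsAlgebraic (Algebra.adjoin K S) L := by
  refine ⟨fun x => ?_⟩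
  have hx : x ∈ IntermediateField.adjoin K S := hS ▸ IntermediateField.mem_top
  obtain ⟨r, hr, s, hs, rfl⟩ := IntermediateField.mem_adjoin_iff_div.mp hx
  rw [div_eq_mul_inv]
  exact (isAlgebraic_algebraMap (⟨r, hr⟩ : Algebra.adjoin K S)).mul
    (isAlgebraic_algebraMap (⟨s, hs⟩ : Algebra.adjoin K S)).inv

theorem algebraicIndependent_gen (K : Type*) [Field K] (n m : ℕ) [NeZero m] :
    AlgebraicIndependent K (gen K n m) := by
  obtain ⟨u, hu, huF⟩ := exists_conj_entriesIn_genField K n m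
  let b : GenIndex n m ⊕ {p : Fin n × Fin n // p.1 < p.2} → FunctionField K n m :=
    Sum.elim (gen K n m) fun p => u p.1.1 p.1.2
  let B := IntermediateField.adjoin K (Set.range b)
  have hgen : genField K n m ≤ B := by
    refine IntermediateField.adjoin_le_iff.mpr ?_
    rintro _ ⟨a, rfl⟩
    exact IntermediateField.subset_adjoin K _ ⟨.inl a, rfl⟩
  have huB : EntriesIn B u := fun i j => by
    rcases lt_trichotomy i j with h | rfl | h
    · exact IntermediateField.subset_adjoin K _ ⟨.inr ⟨(i, j), h⟩, rfl⟩
    · rw [hu.2]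
      exact one_mem B
    · rw [hu.1 i j h]
      exact zero_mem B
  have hXB : ∀ ℓ, EntriesIn B (genericMatrixField K n m ℓ) := fun ℓ => by
    -- Undoing the conjugation recovers the coordinates from u and the normal form.
    have h1 : genericMatrixField K n m ℓ =
        u * (u.adjugate * genericMatrixField K n m ℓ * u) * u.adjugate := by
      rw [← Matrix.mul_assoc, ← Matrix.mul_assoc, hu.mul_adjugate, Matrix.one_mul,
        Matrix.mul_assoc, hu.mul_adjugate, Matrix.mul_one]
    rw [h1]
    exact (huB.mul fun i j => hgen (huF ℓ i j)).mul huB.adjugate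
  have hpoly : ∀ p : CoordRing K n m, algebraMap (CoordRing K n m) (FunctionField K n m) p ∈ B :=
      fun p => by
    induction p using MvPolynomial.induction_on with
    | C c => exact B.algebraMap_mem c
    | add p q hp hq => rw [map_add]; exact add_mem hp hq
    | mul_X p v hp => rw [map_mul]; exact mul_mem hp (hXB v.1 v.2.1 v.2.2)
  have htop : B = ⊤ := by
    refine eq_top_iff.mpr fun f _ => ?_
    obtain ⟨p, q, -, rfl⟩ := IsFractionRing.div_surjective (CoordRing K n m) f
    exact div_mem (hpoly p) (hpoly q)
  have := isAlgebraic_adjoin_of_intermediateField_adjoin_eq_top htop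
  have hfin : Finite (GenIndex n m ⊕ {p : Fin n × Fin n // p.1 < p.2}) :=
    Finite.of_injective _ labelToCoord_injective
  have : Algebra.IsAlgebraic (CoordRing K n m) (FunctionField K n m) :=
    IsLocalization.isAlgebraic _ (nonZeroDivisors (CoordRing K n m))
  have hbasis : IsTranscendenceBasis K (algebraMap (CoordRing K n m) (FunctionField K n m) ∘
      (MvPolynomial.X : _ → CoordRing K n m)) :=
    (IsTranscendenceBasis.mvPolynomial _ K).algebraMap_comp
  have hle := Cardinal.mk_le_of_injective (labelToCoord_injective (n := n) (m := m))
  -- K(H) is algebraic over the algebra generated by `b`, and `b` has at most as many members as the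
  -- transcendence degree, so no member is redundant.
  have hb : IsTranscendenceBasis K b :=
    Algebra.IsAlgebraic.isTranscendenceBasis_of_lift_le_trdeg_of_finite K b
      ((Cardinal.lift_le.mpr hle).trans hbasis.lift_cardinalMk_eq_trdeg.le)
  exact hb.1.comp Sum.inl Sum.inl_injective

end Independence

end MatrixTuples

/-- Over an arbitrary field `K` the field of `U`-invariants is that of the algebraic group `U`; over
an infinite field the same holds for the invariants of the abstract group `U(K)`. -/
theorem mainTheorem2 (K : Type*) [Field K] (n m : ℕ) [NeZero m] :
    MatrixTuples.FreelyGenerates (MatrixTuples.gen K n m) (MatrixTuples.groupInvariants K n m) ∧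
    (Infinite K →
      MatrixTuples.FreelyGenerates (MatrixTuples.gen K n m)
        (MatrixTuples.pointInvariants K n m)) :=
  ⟨⟨MatrixTuples.algebraicIndependent_gen K n m, MatrixTuples.genField_eq_groupInvariants K n m⟩,
    fun _ => ⟨MatrixTuples.algebraicIndependent_gen K n m,
      MatrixTuples.genField_eq_pointInvariants K n m⟩⟩
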